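/- Let $F$ be a probability distribution with mean $\mu$ on a set $\mathcal X\subseteq\mathbb R^d$ carrying a countably generated $\sigma$-field for which the inclusion into $\mathbb R^d$ is measurable, and let $P$ be an $F$-invariant Markov transition kernel on $\mathcal X$. Let $\{X_{st}\}_{t\ge 1}$, $s=1,\dots,m$, be $m\geq 1$ independent stationary Markov chains with transition kernel $P$ and $X_{s1}\sim F$. Put $\Gamma(k)=\mathbb E_F[(X_{s1}-\mu)(X_{s\,1+k}-\mu)^T]$ for $k\ge0$, $\Gamma(k)=\Gamma(-k)^T$ for $k<0$, $\Sigma=\sum_{k\in\mathbb Z}\Gamma(k)$, $\Phi=\sum_{k\in\mathbb Z}|k|\,\Gamma(k)$, $\bar X_s=n^{-1}\sum_{t=1}^nX_{st}$ and $\bar{\bar X}=m^{-1}\sum_{s=1}^m\bar X_s$. For $k\ge0$ define the globally- and locally-centered autocovariance estimators of chain $s$ by \[ \hat\Gamma_{G,s}(k)=\frac1n\sum_{t=1}^{n-k}(X_{st}-\bar{\bar X})(X_{s\,t+k}-\bar{\bar X})^T,\qquad \hat\Gamma_{s}(k)=\frac1n\sum_{t=1}^{n-k}(X_{st}-\bar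 X_s)(X_{s\,t+k}-\bar X_s)^T, \] and for $k<0$ let $\hat\Gamma_{G,s}(k)=\hat\Gamma_{G,s}(-k)^T$ and $\hat\Gamma_s(k)=\hat\Gamma_s(-k)^T$. Assume that $\mathbb E_F\|X_{11}\|^{2+\delta}<\infty$ for some $\delta>0$ and that $P$ is polynomially ergodic of order $\xi>(2+\epsilon)(1+2/\delta)$ for some $\epsilon>0$, that is, there is $M:\mathcal X\to[0,\infty)$ with $\mathbb E_FM<\infty$ and $\|P^n(x,\cdot)-F\|_{TV}\le M(x)\,n^{-\xi}$ for all $x\in\mathcal X$ and $n\ge1$. Then the series defining $\Sigma$ and $\Phi$ converge absolutely, the estimators are integrable, and for every chain $s$ and every fixed lag $k\in\mathbb Z$, as $n\to\infty$, \[ \mathbb E_F\big[\hat\Gamma_{G,s}(k)\big]=\Big(1-\frac{|k|}n\Big)\Big(\Gamma(k)-\frac{\Sigma}{mn}-\frac{\Phi}{mn^2}\Big)+o(n^{-1}), \] \[ \mathbb E_F\big[\hat\Gamma_{s}(k)\big]=\Big(1-\frac{|k|}n\Big)\Big(\Gamma(k)-\frac{\Sigma}{n}-\frac{\Phi}{n^2}\Big)+o(n^{-1}).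 \] Consequently, if $m\ge2$, then for every entry $(i,j)$ with $\Gamma^{ij}(k)\ge0$ and $\Sigma^{ij}>0$ the globally-centered estimator has the smaller bias: for all sufficiently large $n$, \[ \big|\mathbb E_F[\hat\Gamma^{ij}_{G,s}(k)]-\Gamma^{ij}(k)\big|<\big|\mathbb E_F[\hat\Gamma^{ij}_{s}(k)]-\Gamma^{ij}(k)\big|. \] -/

import Mathlib

open MeasureTheory ProbabilityTheory Filter Asymptotics

noncomputable section

namespace GACvF

/-- Total variation distance `sup_A |μ(A) - ν(A)|` of two finite measures. -/
def tvDist {α : Type*} [MeasurableSpace α] (μ ν : Measure α) : ℝ :=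
  ⨆ A : {A : Set α // MeasurableSet A}, |μ.real A.1 - ν.real A.1|

/-- The kernel `P` with invariant law `F` is polynomially ergodic of order `ξ`:
`‖Pⁿ(x, ·) - F‖_TV ≤ M(x) n^(-ξ)` for all states `x` and all `n ≥ 1`, where `M ≥ 0` has
finite expectation under `F`. -/
def PolynomiallyErgodic {α : Type*} [MeasurableSpace α]
    (P : Kernel α α) (F : Measure α) (ξ : ℝ) : Prop :=
  ∃ M : α → ℝ, (∀ x, 0 ≤ M x) ∧ Integrable M F ∧
    ∀ x, ∀ n : ℕ, 1 ≤ n → tvDist ((P ^ n) x) F ≤ M x * (n : ℝ) ^ (-ξ)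

/-- `(X t)` is a time-homogeneous Markov chain with transition kernel `P` and initial law `F`:
given the whole past `X 0, …, X t`, the state `X (t + 1)` has conditional law `P (X t)`. -/
structure IsMarkovChain {Ω α : Type*} [MeasurableSpace Ω] [MeasurableSpace α]
    (Pr : Measure Ω) (P : Kernel α α) (F : Measure α) (X : ℕ → Ω → α) : Prop where
  measurable : ∀ t, Measurable (X t)
  initial : HasLaw (X 0) F Pr
  step : ∀ t : ℕ, HasCondDistrib (X (t + 1)) (fun ω (i : Finset.Iic t) => X i ω)
    (P.comap (fun h : Finset.Iic t → α => h ⟨t, Finset.mem_Iic.2 le_rfl⟩)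
      (measurable_pi_apply _)) Pr

variable {Ω : Type*} [MeasurableSpace Ω] {d m : ℕ}

/-- Autocovariance matrix at lag `k ∈ ℤ` of a stationary process: the cross-covariance matrix of
`Y 0` and `Y k` if `k ≥ 0`, and of `Y (-k)` and `Y 0` if `k < 0` (recall that `Int.toNat` sends
negative integers to `0`). -/
def autocov (Pr : Measure Ω) (Y : ℕ → Ω → EuclideanSpace ℝ (Fin d)) (k : ℤ) :
    Matrix (Fin d) (Fin d) ℝ :=
  Matrix.of fun i j =>
    covariance (fun ω => Y (-k).toNat ω i) (fun ω => Y k.toNat ω j) Pr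

/-- `Σ = ∑_{k ∈ ℤ} Γ(k)`, entrywise. -/
def longRunCov (Pr : Measure Ω) (Y : ℕ → Ω → EuclideanSpace ℝ (Fin d)) :
    Matrix (Fin d) (Fin d) ℝ :=
  Matrix.of fun i j => ∑' k : ℤ, autocov Pr Y k i j

/-- `Φ = ∑_{k ∈ ℤ} |k| Γ(k)`, entrywise. -/
def lagWeightedCov (Pr : Measure Ω) (Y : ℕ → Ω → EuclideanSpace ℝ (Fin d)) :
    Matrix (Fin d) (Fin d) ℝ :=
  Matrix.of fun i j => ∑' k : ℤ, |(k : ℝ)| * autocov Pr Y k i j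

/-- Sample mean of the first `n` observations `y 0, …, y (n - 1)`. -/
def chainMean (n : ℕ) (y : ℕ → EuclideanSpace ℝ (Fin d)) : EuclideanSpace ℝ (Fin d) :=
  (n : ℝ)⁻¹ • ∑ t ∈ Finset.range n, y t

/-- Average of the `m` sample means. -/
def globalMean (n : ℕ) (y : Fin m → ℕ → EuclideanSpace ℝ (Fin d)) : EuclideanSpace ℝ (Fin d) :=
  (m : ℝ)⁻¹ • ∑ s, chainMean n (y s)

/-- `(1/n) ∑_{0 ≤ t < n - h} (y_t - c) (y_{t+h} - c)ᵀ` for a lag `h ≥ 0` and a centre `c`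
(the sum is empty if `h ≥ n`). -/
def lagProduct (n : ℕ) (c : EuclideanSpace ℝ (Fin d)) (y : ℕ → EuclideanSpace ℝ (Fin d))
    (h : ℕ) : Matrix (Fin d) (Fin d) ℝ :=
  (n : ℝ)⁻¹ • ∑ t ∈ Finset.range (n - h),
    Matrix.vecMulVec (fun i => (y t - c) i) (fun j => (y (t + h) - c) j)

/-- Empirical autocovariance at lag `k ∈ ℤ` around the centre `c`, with the value at `k < 0`
being the transpose of the value at `-k`. -/
def sampleAutocov (n : ℕ) (c : EuclideanSpace ℝ (Fin d)) (y : ℕ → EuclideanSpace ℝ (Fin d))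
    (k : ℤ) : Matrix (Fin d) (Fin d) ℝ :=
  if 0 ≤ k then lagProduct n c y k.toNat else (lagProduct n c y (-k).toNat).transpose

/-- Locally-centered autocovariance estimator of chain `s`. -/
def localACvF (n : ℕ) (y : Fin m → ℕ → EuclideanSpace ℝ (Fin d)) (s : Fin m) (k : ℤ) :
    Matrix (Fin d) (Fin d) ℝ :=
  sampleAutocov n (chainMean n (y s)) (y s) k

/-- Globally-centered autocovariance estimator of chain `s`. -/
def globalACvF (n : ℕ) (y : Fin m → ℕ → EuclideanSpace ℝ (Fin d)) (s : Fin m) (k : ℤ) :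
    Matrix (Fin d) (Fin d) ℝ :=
  sampleAutocov n (globalMean n y) (y s) k

/-- Entrywise expectation of a random matrix. -/
def expMatrix (Pr : Measure Ω) (A : Ω → Matrix (Fin d) (Fin d) ℝ) : Matrix (Fin d) (Fin d) ℝ :=
  Matrix.of fun i j => ∫ ω, A ω i j ∂Pr

end GACvF

end

open scoped Topology

namespace GACvF

/-! ### Averages of two-sided summable sequences -/

/-! Both estimators center at the average of the sample means over a set `R` of chains: all chains,
or `{s}` alone. It suffices to show that `n` times the bias tends to `-|k| Γ(k) - Σ / |R|`. After
centering at the true mean, the cross-product expands into four terms. The first gives `(1 - |k|/n)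
Γ(k)`. In the three terms involving the pooled mean, independence removes cross-chain covariances
and leaves a factor `1/|R|`; scaled by `n`, each tends to `Σ / |R|`, with signs `-`, `-`, `+`
(`integral_crossProduct`, `tendsto_mul_integral_crossProduct_sub`). These limits are Cesàro limits
and need only absolute summability of `Γ`. The `Φ` term is of order `n⁻²`, hence invisible at
precision `o(n⁻¹)`.

Summability comes from truncating at level `T`: the tails cost `T ^ (-δ)` by the moment bound, the
bounded part costs `T ^ 2` times the total variation distance. Balancing the two gives `|Γ(l)| ≤ C l
^ (-(2 + ε))` (`PolynomiallyErgodic.exists_abs_covariance_le`), so even `|l| |Γ(l)|` is summable. -/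

lemma tendsto_double_sum {A : ℤ → ℝ} (hA : Summable A) :
    Tendsto (fun n : ℕ => (n : ℝ)⁻¹ *
      ∑ u ∈ Finset.range n, ∑ v ∈ Finset.range n, A ((v : ℤ) - u)) atTop (𝓝 (∑' k, A k)) := by
  have h1 : Summable fun n : ℕ => A n := hA.comp_injective Nat.cast_injective
  have h2 : Summable fun n : ℕ => A (-((n : ℤ) + 1)) :=
    hA.comp_injective (i := fun n : ℕ => -((n : ℤ) + 1)) fun a b hab => by simpa using hab
  have hlim : Tendsto (fun n : ℕ => ∑ k ∈ Finset.range (n + 1), A k +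
      ∑ k ∈ Finset.range n, A (-((k : ℤ) + 1))) atTop (𝓝 (∑' k, A k)) := by
    rw [tsum_of_nat_of_neg_add_one h1 h2]
    exact ((tendsto_add_atTop_iff_nat 1).2 h1.hasSum.tendsto_sum_nat).add
      h2.hasSum.tendsto_sum_nat
  -- Enlarging the square from side `n` to `n + 1` adds a row, a column and a corner, which together
  -- make the symmetric partial sum over `|k| ≤ n`. The double sum is thus a sum of partial sums.
  refine hlim.cesaro.congr fun n => ?_
  congr 1
  induction n with
  | zero => simp
  | succ n ih =>
    have e1 : ∑ u ∈ Finset.range n, A ((n : ℤ) - u) = ∑ k ∈ Finset.range n, A ((k : ℤ) + 1) := by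
      rw [← Finset.sum_range_reflect]
      refine Finset.sum_congr rfl fun k hk => ?_
      have := Finset.mem_range.1 hk
      congr 1; omega
    have e2 : ∑ u ∈ Finset.range n, A ((u : ℤ) - n) =
        ∑ k ∈ Finset.range n, A (-((k : ℤ) + 1)) := by
      rw [← Finset.sum_range_reflect]
      refine Finset.sum_congr rfl fun k hk => ?_
      have := Finset.mem_range.1 hk
      congr 1; omega
    have e3 : ∑ k ∈ Finset.range (n + 1), A k = ∑ k ∈ Finset.range n, A ((k : ℤ) + 1) + A 0 := by
      rw [Finset.sum_range_succ']; simp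
    rw [Finset.sum_range_succ, ih, e3, Finset.sum_range_succ]
    simp_rw [Finset.sum_range_succ _ n, Finset.sum_add_distrib]
    rw [e1, e2, sub_self]
    ring

lemma abs_sum_comp_le {A : ℤ → ℝ} (hA : Summable fun k => |A k|) {f : ℕ → ℤ}
    (hf : Function.Injective f) (s : Finset ℕ) : |∑ u ∈ s, A (f u)| ≤ ∑' k, |A k| := by
  refine (Finset.abs_sum_le_sum_abs _ _).trans ?_
  have := hA.sum_le_tsum (s.map ⟨f, hf⟩) fun _ _ => abs_nonneg _
  rwa [Finset.sum_map] at this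

lemma tendsto_inv_mul_of_abs_sub_le {D E : ℕ → ℝ} {l C : ℝ}
    (hD : Tendsto (fun n : ℕ => (n : ℝ)⁻¹ * D n) atTop (𝓝 l))
    (h : ∀ᶠ n in atTop, |E n - D n| ≤ C) :
    Tendsto (fun n : ℕ => (n : ℝ)⁻¹ * E n) atTop (𝓝 l) := by
  have h0 : Tendsto (fun n : ℕ => (n : ℝ)⁻¹ * (E n - D n)) atTop (𝓝 0) := by
    refine squeeze_zero_norm' (a := fun n : ℕ => (n : ℝ)⁻¹ * C) ?_ ?_
    · filter_upwards [h] with n hn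
      rw [norm_mul, Real.norm_eq_abs, Real.norm_eq_abs, abs_of_nonneg (by positivity)]
      gcongr
    · simpa using (tendsto_inv_atTop_nhds_zero_nat (𝕜 := ℝ)).mul_const C
  have := h0.add hD
  rw [zero_add] at this
  exact this.congr fun n => by ring

/-- Only `h` rows of the full square are missing, and each is a sum over distinct lags, hence at
most `∑' |A k|`; division by `n` removes them. Here the first `h` rows are missing; in
`tendsto_double_sum_trunc`, the last `h`. -/
lemma tendsto_double_sum_lead {A : ℤ → ℝ} (hA : Summable fun k => |A k|) (h : ℕ) :
    Tendsto (fun n : ℕ => (n : ℝ)⁻¹ *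
      ∑ t ∈ Finset.range (n - h), ∑ u ∈ Finset.range n, A (((t + h : ℕ) : ℤ) - u))
      atTop (𝓝 (∑' k, A k)) := by
  refine tendsto_inv_mul_of_abs_sub_le (C := h * ∑' k, |A k|) (tendsto_double_sum hA.of_abs) ?_
  filter_upwards [eventually_ge_atTop h] with n hn
  have e : ∑ u ∈ Finset.range n, ∑ v ∈ Finset.range n, A ((v : ℤ) - u) =
      ∑ t ∈ Finset.range (h + (n - h)), ∑ u ∈ Finset.range n, A ((t : ℤ) - u) := by
    rw [Finset.sum_comm, Nat.add_sub_of_le hn]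
  rw [e, Finset.sum_range_add]
  simp_rw [Nat.add_comm h]
  rw [sub_add_cancel_right, abs_neg]
  refine (Finset.abs_sum_le_sum_abs _ _).trans ((Finset.sum_le_card_nsmul _ _
    (∑' k, |A k|) fun (t : ℕ) _ => abs_sum_comp_le hA (f := fun u : ℕ => (t : ℤ) - u)
      (fun a b hab => ?_) (Finset.range n)).trans ?_)
  · simpa using hab
  · simp

lemma tendsto_double_sum_trunc {A : ℤ → ℝ} (hA : Summable fun k => |A k|) (h : ℕ) :
    Tendsto (fun n : ℕ => (n : ℝ)⁻¹ *
      ∑ t ∈ Finset.range (n - h), ∑ v ∈ Finset.range n, A ((v : ℤ) - t))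
      atTop (𝓝 (∑' k, A k)) := by
  refine tendsto_inv_mul_of_abs_sub_le (C := h * ∑' k, |A k|) (tendsto_double_sum hA.of_abs) ?_
  filter_upwards [eventually_ge_atTop h] with n hn
  have e : ∑ u ∈ Finset.range n, ∑ v ∈ Finset.range n, A ((v : ℤ) - u) =
      ∑ t ∈ Finset.range ((n - h) + h), ∑ v ∈ Finset.range n, A ((v : ℤ) - t) := by
    rw [Nat.sub_add_cancel hn]
  rw [e, Finset.sum_range_add, sub_add_cancel_left, abs_neg]
  refine (Finset.abs_sum_le_sum_abs _ _).trans ((Finset.sum_le_card_nsmul _ _ _ fun (t : ℕ) _ =>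
    abs_sum_comp_le hA (f := fun v : ℕ => (v : ℤ) - ((n - h + t : ℕ) : ℤ))
      (fun a b hab => ?_) _).trans ?_)
  · simpa using hab
  · simp

/-! ### Total variation -/

section TotalVariation

variable {α : Type*} [MeasurableSpace α]

lemma abs_measureReal_sub_le_tvDist (μ ν : Measure α) [IsProbabilityMeasure μ]
    [IsProbabilityMeasure ν] {s : Set α} (hs : MeasurableSet s) :
    |μ.real s - ν.real s| ≤ tvDist μ ν := by
  refine le_ciSup (f := fun A : {A : Set α // MeasurableSet A} => |μ.real A.1 - ν.real A.1|)
    ⟨1, ?_⟩ ⟨s, hs⟩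
  rintro _ ⟨A, rfl⟩
  exact abs_sub_le_of_nonneg_of_le measureReal_nonneg measureReal_le_one measureReal_nonneg
    measureReal_le_one

/-- Layer-cake formula: both integrals are integrals over `t ∈ (0, C]` of the mass of `{t ≤ g}`, and
these masses differ by at most the total variation distance. -/
lemma abs_integral_sub_le_of_nonneg (μ ν : Measure α) [IsProbabilityMeasure μ]
    [IsProbabilityMeasure ν] {g : α → ℝ} (hg : Measurable g) {C : ℝ} (hC : 0 ≤ C)
    (h0 : ∀ x, 0 ≤ g x) (h1 : ∀ x, g x ≤ C) :
    |∫ x, g x ∂μ - ∫ x, g x ∂ν| ≤ C * tvDist μ ν := by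
  have key (ρ : Measure α) [IsProbabilityMeasure ρ] :
      ∫ x, g x ∂ρ = ∫ t in Set.Ioc 0 C, ρ.real {a | t ≤ g a} :=
    (Integrable.of_bound hg.aestronglyMeasurable C (ae_of_all _ fun x => by
      rw [Real.norm_eq_abs, abs_of_nonneg (h0 x)]; exact h1 x)).integral_eq_integral_Ioc_meas_le
      (ae_of_all _ h0) (ae_of_all _ h1)
  have hint (ρ : Measure α) [IsProbabilityMeasure ρ] :
      IntegrableOn (fun t => ρ.real {a | t ≤ g a}) (Set.Ioc 0 C) := by
    have hanti : Antitone fun t => ρ.real {a | t ≤ g a} := fun s t hst =>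
      measureReal_mono fun a (ha : t ≤ g a) => hst.trans ha
    exact Integrable.of_bound hanti.measurable.aestronglyMeasurable 1 (ae_of_all _ fun t => by
      rw [Real.norm_eq_abs, abs_of_nonneg measureReal_nonneg]; exact measureReal_le_one)
  rw [key μ, key ν, ← integral_sub (hint μ) (hint ν)]
  have := norm_setIntegral_le_of_norm_le_const (μ := volume) (s := Set.Ioc 0 C)
    (f := fun t => μ.real {a | t ≤ g a} - ν.real {a | t ≤ g a}) (C := tvDist μ ν)
    (by simp) fun t _ => abs_measureReal_sub_le_tvDist μ ν (hg measurableSet_Ici)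
  rwa [Real.volume_real_Ioc_of_le hC, sub_zero, mul_comm] at this

lemma abs_integral_sub_le (μ ν : Measure α) [IsProbabilityMeasure μ]
    [IsProbabilityMeasure ν] {g : α → ℝ} (hg : Measurable g) {C : ℝ} (hC : 0 ≤ C)
    (h : ∀ x, |g x| ≤ C) :
    |∫ x, g x ∂μ - ∫ x, g x ∂ν| ≤ 2 * C * tvDist μ ν := by
  have hi (ρ : Measure α) [IsProbabilityMeasure ρ] : Integrable g ρ :=
    Integrable.of_bound hg.aestronglyMeasurable C (ae_of_all _ h)
  -- Shifting `g` by `C` puts it in `[0, 2C]` and leaves the difference of integrals unchanged; this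
  -- is the source of the factor `2`.
  have := abs_integral_sub_le_of_nonneg μ ν (hg.add_const C) (C := 2 * C) (by positivity)
    (fun x => by linarith [(abs_le.1 (h x)).1]) (fun x => by linarith [(abs_le.1 (h x)).2])
  simpa [integral_add (hi μ) (integrable_const C), integral_add (hi ν) (integrable_const C)]
    using this

end TotalVariation

/-! ### Two-point laws of a Markov chain -/

section Law

variable {Ω α : Type*} [MeasurableSpace Ω] [MeasurableSpace α] {Pr : Measure Ω}
  {P : Kernel α α} {F : Measure α} {X : ℕ → Ω → α}

lemma isMarkovKernel_pow (P : Kernel α α) [IsMarkovKernel P] (n : ℕ) :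
    IsMarkovKernel (P ^ n) := by
  induction n with
  | zero => exact inferInstanceAs (IsMarkovKernel (Kernel.id : Kernel α α))
  | succ n ih =>
    rw [pow_succ]
    exact inferInstanceAs (IsMarkovKernel ((P ^ n) ∘ₖ P))

/-- The conditional law given the whole past reads only coordinate `t`, so it factors through the
pair of coordinates `(s, t)` and the conditioning can be coarsened to that pair. -/
lemma IsMarkovChain.map_pair_succ [IsProbabilityMeasure Pr] [IsMarkovKernel P]
    (hX : IsMarkovChain Pr P F X) {s t : ℕ} (hst : s ≤ t) :
    Pr.map (fun ω => ((X s ω, X t ω), X (t + 1) ω)) =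
      Pr.map (fun ω => (X s ω, X t ω)) ⊗ₘ P.comap Prod.snd measurable_snd := by
  have hf : Measurable fun h : Finset.Iic t → α =>
      (h ⟨s, Finset.mem_Iic.2 hst⟩, h ⟨t, Finset.mem_Iic.2 le_rfl⟩) := by fun_prop
  have h : HasCondDistrib (X (t + 1)) (fun ω (i : Finset.Iic t) => X i ω)
      ((P.comap Prod.snd measurable_snd).comap _ hf) Pr := hX.step t
  exact h.comp_right.map_eq

/-- Assuming the law at the single time `s` avoids circularity: the case `l = 1` is what propagates
stationarity in `IsMarkovChain.map_eq`. -/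
lemma IsMarkovChain.map_pair_of_map_eq [IsProbabilityMeasure Pr] [IsMarkovKernel P]
    [IsProbabilityMeasure F]
    (hX : IsMarkovChain Pr P F X) {s : ℕ} (hs : Pr.map (X s) = F) (l : ℕ) :
    Pr.map (fun ω => (X s ω, X (s + l) ω)) = F ⊗ₘ (P ^ l) := by
  have hm := hX.measurable
  have hMk := isMarkovKernel_pow P
  induction l with
  | zero =>
    rw [pow_zero]
    change _ = F ⊗ₘ Kernel.id
    rw [Measure.compProd_id, ← hs, Measure.map_map (by fun_prop) (by fun_prop)]
    rfl
  | succ l ih =>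
    have h1 := hX.map_pair_succ (Nat.le_add_right s l)
    have h2 : Pr.map (fun ω => (X s ω, X (s + l + 1) ω)) =
        (Pr.map fun ω => ((X s ω, X (s + l) ω), X (s + l + 1) ω)).map
          fun p : (α × α) × α => (p.1.1, p.2) := by
      rw [Measure.map_map (by fun_prop) (by fun_prop)]
      rfl
    rw [← add_assoc, h2, h1, ih]
    ext A hA
    have hA' : MeasurableSet ((fun p : (α × α) × α => (p.1.1, p.2)) ⁻¹' A) :=
      hA.preimage (by fun_prop)
    rw [Measure.map_apply (by fun_prop) hA, Measure.compProd_apply hA',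
      Measure.lintegral_compProd (Kernel.measurable_kernel_prodMk_left hA'),
      Measure.compProd_apply hA]
    refine lintegral_congr fun x => ?_
    rw [Kernel.pow_succ_apply_eq_lintegral _ _ _ (measurable_prodMk_left hA)]
    rfl

lemma IsMarkovChain.map_eq [IsProbabilityMeasure Pr] [IsMarkovKernel P]
    [IsProbabilityMeasure F] (hX : IsMarkovChain Pr P F X) (hinv : Kernel.Invariant P F) (t : ℕ) :
    Pr.map (X t) = F := by
  have hm := hX.measurable
  have hMk := isMarkovKernel_pow P
  induction t with
  | zero => exact hX.initial.map_eq
  | succ t ih =>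
    have h := congrArg Measure.snd (hX.map_pair_of_map_eq ih 1)
    rw [Measure.snd_map_prodMk (by fun_prop), Measure.snd_compProd, pow_one] at h
    rw [h, hinv.def]

lemma IsMarkovChain.map_pair [IsProbabilityMeasure Pr] [IsMarkovKernel P]
    [IsProbabilityMeasure F] (hX : IsMarkovChain Pr P F X) (hinv : Kernel.Invariant P F)
    (s l : ℕ) : Pr.map (fun ω => (X s ω, X (s + l) ω)) = F ⊗ₘ (P ^ l) :=
  hX.map_pair_of_map_eq (hX.map_eq hinv s) l

end Law

/-! ### Decay of covariances under polynomial ergodicity -/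

section Truncation

/-- `x` if `|x| ≤ T`, and `0` otherwise. -/
noncomputable def trunc (T x : ℝ) : ℝ := (Set.Icc (-T) T).indicator id x

lemma abs_trunc_le {T : ℝ} (hT : 0 ≤ T) (x : ℝ) : |trunc T x| ≤ T := by
  unfold trunc
  by_cases h : x ∈ Set.Icc (-T) T
  · rw [Set.indicator_of_mem h]; exact abs_le.2 h
  · rwa [Set.indicator_of_notMem h, abs_zero]

lemma measurable_trunc (T : ℝ) : Measurable (trunc T) :=
  measurable_id.indicator measurableSet_Icc

lemma sq_le_rpow_mul {T δ z : ℝ} (hT : 0 < T) (hδ : 0 < δ) (hz : T < z) :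
    z ^ 2 ≤ T ^ (-δ) * z ^ (2 + δ) := by
  have hz0 : 0 < z := hT.trans hz
  rw [Real.rpow_add hz0, Real.rpow_two, Real.rpow_neg hT.le, mul_left_comm]
  refine le_mul_of_one_le_right (sq_nonneg z) ?_
  rw [inv_mul_eq_div, one_le_div (Real.rpow_pos_of_pos hT δ)]
  exact Real.rpow_le_rpow hT.le hz.le hδ.le

/-- If either factor exceeds `T` in modulus, the truncated product vanishes, and `|x y|` is at most
the square of the larger modulus `z > T`, where `z ^ 2 ≤ T ^ (-δ) * z ^ (2 + δ)`. -/
lemma abs_mul_sub_trunc_le {T δ : ℝ} (hT : 0 < T) (hδ : 0 < δ) (x y : ℝ) :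
    |x * y - trunc T x * trunc T y| ≤ T ^ (-δ) * (|x| ^ (2 + δ) + |y| ^ (2 + δ)) := by
  have hTδ := Real.rpow_nonneg hT.le (-δ)
  have hx0 := Real.rpow_nonneg (abs_nonneg x) (2 + δ)
  have hy0 := Real.rpow_nonneg (abs_nonneg y) (2 + δ)
  by_cases hx : |x| ≤ T ∧ |y| ≤ T
  · have e1 : trunc T x = x :=
      Set.indicator_of_mem (s := Set.Icc (-T) T) (abs_le.1 hx.1) id
    have e2 : trunc T y = y :=
      Set.indicator_of_mem (s := Set.Icc (-T) T) (abs_le.1 hx.2) id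
    rw [e1, e2, sub_self, abs_zero]
    positivity
  · have e : trunc T x * trunc T y = 0 := by
      rw [mul_eq_zero]
      by_contra! h
      exact hx ⟨abs_le.2 (Set.mem_of_indicator_ne_zero (s := Set.Icc (-T) T) h.1),
        abs_le.2 (Set.mem_of_indicator_ne_zero (s := Set.Icc (-T) T) h.2)⟩
    rw [e, sub_zero, abs_mul]
    rcases le_total |x| |y| with h | h
    · have hy : T < |y| := by
        by_contra! hy
        exact hx ⟨h.trans hy, hy⟩
      nlinarith [sq_le_rpow_mul hT hδ hy, mul_nonneg hTδ hx0, abs_nonneg x, abs_nonneg y]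
    · have hy : T < |x| := by
        by_contra! hy
        exact hx ⟨hy, h.trans hy⟩
      nlinarith [sq_le_rpow_mul hT hδ hy, mul_nonneg hTδ hy0, abs_nonneg x, abs_nonneg y]

end Truncation

lemma invariant_pow {α : Type*} [MeasurableSpace α] {F : Measure α} {P : Kernel α α}
    (hinv : Kernel.Invariant P F) (n : ℕ) :
    Kernel.Invariant (P ^ n) F := by
  induction n with
  | zero => exact Measure.id_comp
  | succ n ih => rw [pow_succ]; exact ih.comp hinv

section Covariance

variable {α : Type*} [MeasurableSpace α] {F : Measure α} [IsProbabilityMeasure F]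
  {f g : α → ℝ} {δ : ℝ}

lemma memLp_two_of_integrable_rpow (hf : Measurable f) (hδ : 0 < δ)
    (hfi : Integrable (fun x => |f x| ^ (2 + δ)) F) : MemLp f 2 F := by
  refine (memLp_two_iff_integrable_sq hf.aestronglyMeasurable).2
    ((hfi.add (integrable_const 1)).mono' (by fun_prop) (ae_of_all _ fun x => ?_))
  rw [Real.norm_eq_abs, abs_of_nonneg (sq_nonneg _), ← sq_abs]
  rcases le_or_gt |f x| 1 with h | h
  · have : |f x| ^ 2 ≤ 1 := pow_le_one₀ (abs_nonneg _) h
    have := Real.rpow_nonneg (abs_nonneg (f x)) (2 + δ)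
    simp only [Pi.add_apply]
    linarith
  · have := sq_le_rpow_mul one_pos hδ h
    rw [Real.one_rpow, one_mul] at this
    simp only [Pi.add_apply]
    linarith

/-- The bound depends on `ρ` only through its marginals, so it serves both the law of a pair of
states and the product `F.prod F`. -/
lemma abs_integral_mul_sub_trunc_le {ρ : Measure (α × α)} [IsProbabilityMeasure ρ]
    (h1 : ρ.map Prod.fst = F) (h2 : ρ.map Prod.snd = F)
    (hf : Measurable f) (hg : Measurable g) (hδ : 0 < δ)
    (hfi : Integrable (fun x => |f x| ^ (2 + δ)) F)
    (hgi : Integrable (fun x => |g x| ^ (2 + δ)) F) {T : ℝ} (hT : 0 < T) :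
    |∫ p, f p.1 * g p.2 ∂ρ - ∫ p, trunc T (f p.1) * trunc T (g p.2) ∂ρ| ≤
      T ^ (-δ) * (∫ x, |f x| ^ (2 + δ) ∂F + ∫ x, |g x| ^ (2 + δ) ∂F) := by
  have mp1 : MeasurePreserving Prod.fst ρ F := ⟨measurable_fst, h1⟩
  have mp2 : MeasurePreserving Prod.snd ρ F := ⟨measurable_snd, h2⟩
  have hfg : Integrable (fun p => f p.1 * g p.2) ρ :=
    ((memLp_two_of_integrable_rpow hf hδ hfi).comp_measurePreserving mp1).integrable_mul
      ((memLp_two_of_integrable_rpow hg hδ hgi).comp_measurePreserving mp2)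
  have hmt := measurable_trunc T
  have htr : Integrable (fun p : α × α => trunc T (f p.1) * trunc T (g p.2)) ρ := by
    refine Integrable.of_bound (by fun_prop) (T * T) (ae_of_all _ fun p => ?_)
    rw [norm_mul]
    exact mul_le_mul (abs_trunc_le hT.le _) (abs_trunc_le hT.le _) (abs_nonneg _) hT.le
  have hf' : Integrable (fun p : α × α => |f p.1| ^ (2 + δ)) ρ :=
    mp1.integrable_comp_of_integrable hfi
  have hg' : Integrable (fun p : α × α => |g p.2| ^ (2 + δ)) ρ :=
    mp2.integrable_comp_of_integrable hgi
  rw [← integral_sub hfg htr]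
  refine (norm_integral_le_of_norm_le
    (f := fun p : α × α => f p.1 * g p.2 - trunc T (f p.1) * trunc T (g p.2))
    (g := fun p : α × α => T ^ (-δ) * (|f p.1| ^ (2 + δ) + |g p.2| ^ (2 + δ)))
    ((hf'.add hg').const_mul (T ^ (-δ)))
    (ae_of_all _ fun p => abs_mul_sub_trunc_le hT hδ (f p.1) (g p.2))).trans_eq ?_
  have e1 : ∫ x, |f x| ^ (2 + δ) ∂F = ∫ p, |f p.1| ^ (2 + δ) ∂ρ := by
    rw [← h1, integral_map (by fun_prop) (hf.abs.pow_const (2 + δ)).aestronglyMeasurable]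
  have e2 : ∫ x, |g x| ^ (2 + δ) ∂F = ∫ p, |g p.2| ^ (2 + δ) ∂ρ := by
    rw [← h2, integral_map (by fun_prop) (hg.abs.pow_const (2 + δ)).aestronglyMeasurable]
  rw [integral_const_mul, e1, e2]
  rw [integral_add hf' hg']

/-- Conditioning on the first coordinate leaves `f x` times the difference of the integrals of `g`
under `Q x` and `F`, at most `T * (2 * T * B x)`. -/
lemma abs_integral_compProd_sub_le {Q : Kernel α α} [IsMarkovKernel Q]
    (hf : Measurable f) (hg : Measurable g) {T : ℝ} (hT : 0 ≤ T)
    (hfT : ∀ x, |f x| ≤ T) (hgT : ∀ x, |g x| ≤ T) {B : α → ℝ} (hB : Integrable B F)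
    (hQ : ∀ x, tvDist (Q x) F ≤ B x) :
    |∫ p, f p.1 * g p.2 ∂(F ⊗ₘ Q) - (∫ x, f x ∂F) * ∫ x, g x ∂F| ≤
      2 * T ^ 2 * ∫ x, B x ∂F := by
  have hfg : Integrable (fun p : α × α => f p.1 * g p.2) (F ⊗ₘ Q) := by
    refine Integrable.of_bound (by fun_prop) (T * T) (ae_of_all _ fun p => ?_)
    rw [norm_mul]
    exact mul_le_mul (hfT _) (hgT _) (abs_nonneg _) hT
  have hfi : Integrable f F := Integrable.of_bound (by fun_prop) T (ae_of_all _ hfT)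
  have hi : Integrable (fun x => f x * ∫ y, g y ∂(Q x)) F := by
    -- The lemma is about kernels, so `F` is viewed as a constant kernel on `Unit`.
    have := MeasureTheory.Integrable.integral_compProd
      (κ := Kernel.const Unit F) (η := Kernel.prodMkLeft Unit Q) (a := ()) hfg
    simpa only [integral_const_mul, Kernel.prodMkLeft_apply, Kernel.const_apply] using this
  rw [Measure.integral_compProd hfg]
  simp_rw [integral_const_mul]
  rw [← integral_mul_const, ← integral_sub hi (hfi.mul_const _)]
  refine (norm_integral_le_of_norm_le (f := fun x => f x * ∫ y, g y ∂(Q x) - f x * ∫ y, g y ∂F)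
    (hB.const_mul (2 * T ^ 2))
    (ae_of_all _ fun x => ?_)).trans_eq (integral_const_mul _ _)
  rw [← mul_sub, norm_mul]
  have h := (abs_integral_sub_le (Q x) F hg hT hgT).trans
    (mul_le_mul_of_nonneg_left (hQ x) (by positivity))
  calc ‖f x‖ * ‖∫ y, g y ∂(Q x) - ∫ y, g y ∂F‖ ≤ T * (2 * T * B x) :=
        mul_le_mul (hfT x) h (norm_nonneg _) hT
    _ = _ := by ring

lemma abs_covariance_le {Q : Kernel α α} [IsMarkovKernel Q] (hQF : Kernel.Invariant Q F)
    (hf : Measurable f) (hg : Measurable g) (hδ : 0 < δ)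
    (hfi : Integrable (fun x => |f x| ^ (2 + δ)) F)
    (hgi : Integrable (fun x => |g x| ^ (2 + δ)) F) {B : α → ℝ} (hB : Integrable B F)
    (hQ : ∀ x, tvDist (Q x) F ≤ B x) {T : ℝ} (hT : 0 < T) :
    |∫ p, f p.1 * g p.2 ∂(F ⊗ₘ Q) - (∫ x, f x ∂F) * ∫ x, g x ∂F| ≤
      2 * T ^ (-δ) * (∫ x, |f x| ^ (2 + δ) ∂F + ∫ x, |g x| ^ (2 + δ) ∂F) +
        2 * T ^ 2 * ∫ x, B x ∂F := by
  have hmt := measurable_trunc T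
  have b1 := abs_integral_mul_sub_trunc_le (ρ := F ⊗ₘ Q) (F := F)
    (by change (F ⊗ₘ Q).fst = F; rw [Measure.fst_compProd])
    (by change (F ⊗ₘ Q).snd = F; rw [Measure.snd_compProd, hQF.def]) hf hg hδ hfi hgi hT
  have b2 := abs_integral_mul_sub_trunc_le (ρ := F.prod F) (F := F)
    (by change (F.prod F).fst = F; rw [Measure.fst_prod])
    (by change (F.prod F).snd = F; rw [Measure.snd_prod]) hf hg hδ hfi hgi hT
  have b3 := abs_integral_compProd_sub_le (F := F) (Q := Q) (f := fun x => trunc T (f x))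
    (g := fun x => trunc T (g x)) (by fun_prop) (by fun_prop) hT.le
    (fun x => abs_trunc_le hT.le _) (fun x => abs_trunc_le hT.le _) hB hQ
  rw [integral_prod_mul f g,
    integral_prod_mul (fun x => trunc T (f x)) (fun x => trunc T (g x))] at b2
  rw [abs_le] at *
  constructor <;> linarith [b1.1, b1.2, b2.1, b2.2, b3.1, b3.2]

lemma PolynomiallyErgodic.exists_abs_covariance_le {P : Kernel α α} [IsMarkovKernel P] {ξ ε : ℝ}
    (hP : PolynomiallyErgodic P F ξ) (hinv : Kernel.Invariant P F)
    (hf : Measurable f) (hg : Measurable g) (hδ : 0 < δ) (hξ : (2 + ε) * (1 + 2 / δ) < ξ)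
    (hfi : Integrable (fun x => |f x| ^ (2 + δ)) F)
    (hgi : Integrable (fun x => |g x| ^ (2 + δ)) F) :
    ∃ C : ℝ, ∀ l : ℕ, 1 ≤ l →
      |∫ p, f p.1 * g p.2 ∂(F ⊗ₘ (P ^ l)) - (∫ x, f x ∂F) * ∫ x, g x ∂F| ≤
        C * (l : ℝ) ^ (-(2 + ε)) := by
  obtain ⟨M, hM0, hMi, hM⟩ := hP
  have hMk := isMarkovKernel_pow P
  refine ⟨2 * (∫ x, |f x| ^ (2 + δ) ∂F + ∫ x, |g x| ^ (2 + δ) ∂F) + 2 * ∫ x, M x ∂F,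
    fun l hl => ?_⟩
  have hl1 : (1 : ℝ) ≤ l := by exact_mod_cast hl
  have hl0 : (0 : ℝ) < l := by linarith
  -- This truncation level makes `T ^ (-δ)` exactly `l ^ (-(2 + ε))`; the lower bound on `ξ` is then
  -- what `T ^ 2 * l ^ (-ξ)` needs to decay at least as fast.
  have hT : 0 < (l : ℝ) ^ ((2 + ε) / δ) := Real.rpow_pos_of_pos hl0 _
  refine (abs_covariance_le (invariant_pow hinv l) hf hg hδ hfi hgi
    (hMi.mul_const ((l : ℝ) ^ (-ξ))) (fun x => hM x l hl) hT).trans ?_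
  have e1 : ((l : ℝ) ^ ((2 + ε) / δ)) ^ (-δ) = (l : ℝ) ^ (-(2 + ε)) := by
    rw [← Real.rpow_mul hl0.le]
    congr 1
    field_simp
  have e2 : ((l : ℝ) ^ ((2 + ε) / δ)) ^ 2 * (l : ℝ) ^ (-ξ) ≤ (l : ℝ) ^ (-(2 + ε)) := by
    rw [← Real.rpow_natCast, ← Real.rpow_mul hl0.le, ← Real.rpow_add hl0]
    refine Real.rpow_le_rpow_of_exponent_le hl1 ?_
    have : (2 + ε) * (1 + 2 / δ) = (2 + ε) + (2 + ε) / δ * 2 := by ring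
    push_cast
    linarith
  have hM' : 0 ≤ ∫ x, M x ∂F := integral_nonneg hM0
  rw [e1, integral_mul_const]
  nlinarith [mul_le_mul_of_nonneg_left e2 hM']

lemma summable_of_abs_le_rpow {A : ℤ → ℝ} {ε C₁ C₂ : ℝ} (hε : 0 < ε)
    (h₁ : ∀ l : ℕ, 1 ≤ l → |A l| ≤ C₁ * (l : ℝ) ^ (-(2 + ε)))
    (h₂ : ∀ l : ℕ, 1 ≤ l → |A (-l)| ≤ C₂ * (l : ℝ) ^ (-(2 + ε))) :
    (Summable fun l : ℤ => |A l|) ∧ Summable fun l : ℤ => |(l : ℝ)| * |A l| := by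
  have hs2 : Summable fun n : ℕ => (n : ℝ) ^ (-(1 + ε)) :=
    Real.summable_nat_rpow.2 (by linarith)
  have aux {a : ℕ → ℝ} {C : ℝ} (h : ∀ l : ℕ, 1 ≤ l → |a l| ≤ C * (l : ℝ) ^ (-(2 + ε))) :
      Summable fun l : ℕ => (l : ℝ) * |a l| := by
    refine Summable.of_norm_bounded_eventually_nat (hs2.mul_left C) ?_
    filter_upwards [eventually_ge_atTop 1] with l hl
    have hl0 : (0 : ℝ) < l := by exact_mod_cast hl
    rw [Real.norm_eq_abs, abs_of_nonneg (by positivity)]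
    calc (l : ℝ) * |a l| ≤ l * (C * (l : ℝ) ^ (-(2 + ε))) := by gcongr; exact h l hl
      _ = C * (l : ℝ) ^ (-(1 + ε)) := by
        have : -(1 + ε) = 1 + -(2 + ε) := by ring
        rw [this, Real.rpow_add hl0, Real.rpow_one]; ring
  have hw : Summable fun l : ℤ => |(l : ℝ)| * |A l| := by
    refine Summable.of_nat_of_neg ?_ ?_
    · simpa using aux h₁
    · simpa using aux h₂
  refine ⟨?_, hw⟩
  refine Summable.of_norm_bounded_eventually hw ?_
  -- The weight `|l|` is at least `1` except at lag `0`, so the weighted series dominates the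
  -- unweighted one off a single index.
  refine (Set.finite_singleton (0 : ℤ)).subset fun l hl => ?_
  by_contra hl0
  refine hl ?_
  have h1 : (1 : ℝ) ≤ |(l : ℝ)| := by exact_mod_cast Int.one_le_abs hl0
  change ‖|A l|‖ ≤ |(l : ℝ)| * |A l|
  rw [Real.norm_eq_abs, abs_abs]
  exact le_mul_of_one_le_left (abs_nonneg _) h1

end Covariance

/-! ### Expectation of empirical cross-products -/

section CrossProduct

variable {Ω : Type*} [MeasurableSpace Ω] {Pr : Measure Ω} {ι : Type*}
  {U V : ι → ℕ → Ω → ℝ} {A : ℤ → ℝ}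

/-- The average of the first `n` values of the sequences `a r` with `r ∈ R`. -/
noncomputable def poolAvg (R : Finset ι) (n : ℕ) (a : ι → ℕ → ℝ) : ℝ :=
  (R.card : ℝ)⁻¹ * ((n : ℝ)⁻¹ * ∑ r ∈ R, ∑ u ∈ Finset.range n, a r u)

lemma poolAvg_sub_const {R : Finset ι} (hR : R.Nonempty) {n : ℕ} (hn : n ≠ 0) (a : ι → ℕ → ℝ)
    (c : ℝ) : poolAvg R n (fun r t => a r t - c) = poolAvg R n a - c := by
  have hR' : (R.card : ℝ) ≠ 0 := by exact_mod_cast hR.card_ne_zero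
  have hn' : (n : ℝ) ≠ 0 := by exact_mod_cast hn
  simp only [poolAvg, Finset.sum_sub_distrib, Finset.sum_const, Finset.card_range, nsmul_eq_mul]
  field_simp

lemma memLp_poolAvg (hU : ∀ r t, MemLp (U r t) 2 Pr) (R : Finset ι) (n : ℕ) :
    MemLp (fun ω => poolAvg R n fun r t => U r t ω) 2 Pr :=
  ((memLp_finsetSum _ fun r _ => memLp_finsetSum _ fun t _ => hU r t).const_mul _).const_mul _

lemma integral_poolAvg_mul (hU : ∀ r t, MemLp (U r t) 2 Pr) {W : Ω → ℝ} (hW : MemLp W 2 Pr)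
    (R : Finset ι) (n : ℕ) :
    ∫ ω, (poolAvg R n fun r t => U r t ω) * W ω ∂Pr =
      poolAvg R n fun r t => ∫ ω, U r t ω * W ω ∂Pr := by
  simp only [poolAvg, mul_assoc, Finset.sum_mul]
  rw [integral_const_mul, integral_const_mul, integral_finsetSum]
  · congr 2
    refine Finset.sum_congr rfl fun r _ => ?_
    rw [integral_finsetSum]
    exact fun t _ => (hU r t).integrable_mul hW
  · exact fun r _ => integrable_finsetSum _ fun t _ => (hU r t).integrable_mul hW

lemma poolAvg_ite [DecidableEq ι] {R : Finset ι} {s : ι} (hs : s ∈ R) (n : ℕ) (a : ℕ → ℝ) :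
    (poolAvg R n fun r t => if r = s then a t else 0) =
      (R.card : ℝ)⁻¹ * ((n : ℝ)⁻¹ * ∑ t ∈ Finset.range n, a t) := by
  unfold poolAvg
  rw [Finset.sum_eq_single s]
  · simp
  · intro r _ hr; simp [hr]
  · exact fun h => absurd hs h

lemma poolAvg_const {R : Finset ι} (hR : R.Nonempty) (n : ℕ) (a : ℕ → ℝ) :
    (poolAvg R n fun _ t => a t) = (n : ℝ)⁻¹ * ∑ t ∈ Finset.range n, a t := by
  have hR' : (R.card : ℝ) ≠ 0 := by exact_mod_cast hR.card_ne_zero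
  simp only [poolAvg, Finset.sum_const, nsmul_eq_mul]
  field_simp

lemma integrable_crossProduct (hU : ∀ r t, MemLp (U r t) 2 Pr) (hV : ∀ r t, MemLp (V r t) 2 Pr)
    (R : Finset ι) (s : ι) (n h : ℕ) :
    Integrable (fun ω => (n : ℝ)⁻¹ * ∑ t ∈ Finset.range (n - h),
      (U s t ω - poolAvg R n fun r t => U r t ω) *
        (V s (t + h) ω - poolAvg R n fun r t => V r t ω)) Pr :=
  (integrable_finsetSum _ fun t _ => ((hU s t).sub (memLp_poolAvg hU R n)).integrable_mul
    ((hV s (t + h)).sub (memLp_poolAvg hV R n))).const_mul _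

/-- In a product of one observation with a pooled mean, only chain `s` survives, giving `1/|R|`. In
the product of the two pooled means, `|R|` diagonal terms meet the weight `|R|⁻²`, giving `1/|R|`
again. -/
lemma integral_crossProduct [DecidableEq ι]
    (hU : ∀ r t, MemLp (U r t) 2 Pr) (hV : ∀ r t, MemLp (V r t) 2 Pr)
    (hUV : ∀ r u r' v, ∫ ω, U r u ω * V r' v ω ∂Pr = if r = r' then A ((v : ℤ) - u) else 0)
    {R : Finset ι} {s : ι} (hs : s ∈ R) (n h : ℕ) :
    ∫ ω, (n : ℝ)⁻¹ * ∑ t ∈ Finset.range (n - h),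
      (U s t ω - poolAvg R n fun r t => U r t ω) *
        (V s (t + h) ω - poolAvg R n fun r t => V r t ω) ∂Pr =
    (n : ℝ)⁻¹ * ∑ t ∈ Finset.range (n - h), (A h
      - (R.card : ℝ)⁻¹ * ((n : ℝ)⁻¹ * ∑ v ∈ Finset.range n, A ((v : ℤ) - t))
      - (R.card : ℝ)⁻¹ * ((n : ℝ)⁻¹ * ∑ u ∈ Finset.range n, A (((t + h : ℕ) : ℤ) - u))
      + (R.card : ℝ)⁻¹ * ((n : ℝ)⁻¹ * ((n : ℝ)⁻¹ *
        ∑ u ∈ Finset.range n, ∑ v ∈ Finset.range n, A ((v : ℤ) - u)))) := by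
  have hUm := memLp_poolAvg hU R n
  have hVm := memLp_poolAvg hV R n
  have right (r : ι) (hr : r ∈ R) (u : ℕ) :
      ∫ ω, U r u ω * (poolAvg R n fun r t => V r t ω) ∂Pr =
        (R.card : ℝ)⁻¹ * ((n : ℝ)⁻¹ * ∑ v ∈ Finset.range n, A ((v : ℤ) - u)) := by
    simp_rw [mul_comm (U r u _)]
    rw [integral_poolAvg_mul hV (hU r u)]
    simp_rw [mul_comm (V _ _ _), hUV, @eq_comm _ r]
    exact poolAvg_ite hr n fun v => A ((v : ℤ) - u)
  rw [integral_const_mul, integral_finsetSum]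
  swap
  · exact fun t _ => ((hU s t).sub hUm).integrable_mul ((hV s (t + h)).sub hVm)
  congr 1
  refine Finset.sum_congr rfl fun t _ => ?_
  have i1 : Integrable (fun ω => U s t ω * V s (t + h) ω) Pr :=
    (hU s t).integrable_mul (hV s (t + h))
  have i2 : Integrable (fun ω => U s t ω * (poolAvg R n fun r t => V r t ω)) Pr :=
    (hU s t).integrable_mul hVm
  have i3 : Integrable (fun ω => (poolAvg R n fun r t => U r t ω) * V s (t + h) ω) Pr :=
    hUm.integrable_mul (hV s (t + h))
  have i4 : Integrable (fun ω => (poolAvg R n fun r t => U r t ω) *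
      (poolAvg R n fun r t => V r t ω)) Pr :=
    hUm.integrable_mul hVm
  have e1 : ∫ ω, U s t ω * V s (t + h) ω ∂Pr = A h := by
    rw [hUV, if_pos rfl]; congr 1; push_cast; ring
  have e3 : ∫ ω, (poolAvg R n fun r t => U r t ω) * V s (t + h) ω ∂Pr =
      (R.card : ℝ)⁻¹ * ((n : ℝ)⁻¹ * ∑ u ∈ Finset.range n, A (((t + h : ℕ) : ℤ) - u)) := by
    rw [integral_poolAvg_mul hU (hV s (t + h))]
    simp_rw [hUV]
    exact poolAvg_ite hs n fun u => A (((t + h : ℕ) : ℤ) - u)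
  have e4 : ∫ ω, (poolAvg R n fun r t => U r t ω) * (poolAvg R n fun r t => V r t ω) ∂Pr =
      (R.card : ℝ)⁻¹ * ((n : ℝ)⁻¹ * ((n : ℝ)⁻¹ *
        ∑ u ∈ Finset.range n, ∑ v ∈ Finset.range n, A ((v : ℤ) - u))) := by
    rw [integral_poolAvg_mul hU hVm]
    have : (poolAvg R n fun r t => ∫ ω, U r t ω * (poolAvg R n fun r t => V r t ω) ∂Pr) =
        poolAvg R n fun _ t =>
          (R.card : ℝ)⁻¹ * ((n : ℝ)⁻¹ * ∑ v ∈ Finset.range n, A ((v : ℤ) - t)) := by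
      unfold poolAvg
      congr 2
      exact Finset.sum_congr rfl fun r hr => Finset.sum_congr rfl fun t _ => right r hr t
    rw [this, poolAvg_const ⟨s, hs⟩, ← Finset.mul_sum, ← Finset.mul_sum]
    ring
  calc _ = ∫ ω, (U s t ω * V s (t + h) ω - U s t ω * (poolAvg R n fun r t => V r t ω)
        - (poolAvg R n fun r t => U r t ω) * V s (t + h) ω
        + (poolAvg R n fun r t => U r t ω) * (poolAvg R n fun r t => V r t ω)) ∂Pr := by
        congr 1; ext ω; ring
    _ = _ := by
      rw [integral_add (by exact (i1.sub i2).sub i3) i4, integral_sub (by exact i1.sub i2) i3,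
        integral_sub i1 i2,
        e1, right s hs t, e3, e4]

lemma tendsto_mul_integral_crossProduct_sub [DecidableEq ι]
    (hU : ∀ r t, MemLp (U r t) 2 Pr) (hV : ∀ r t, MemLp (V r t) 2 Pr)
    (hUV : ∀ r u r' v, ∫ ω, U r u ω * V r' v ω ∂Pr = if r = r' then A ((v : ℤ) - u) else 0)
    (hA : Summable fun k => |A k|) {R : Finset ι} {s : ι} (hs : s ∈ R) (h : ℕ) :
    Tendsto (fun n : ℕ => (n : ℝ) * ((∫ ω, (n : ℝ)⁻¹ * ∑ t ∈ Finset.range (n - h),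
      (U s t ω - poolAvg R n fun r t => U r t ω) *
        (V s (t + h) ω - poolAvg R n fun r t => V r t ω) ∂Pr) - A h)) atTop
      (𝓝 (-(h * A h) - (∑' k, A k) / R.card)) := by
  have t1 := (tendsto_double_sum_trunc hA h).const_mul (R.card : ℝ)⁻¹
  have t2 := (tendsto_double_sum_lead hA h).const_mul (R.card : ℝ)⁻¹
  have t3 := (tendsto_double_sum hA.of_abs).const_mul (R.card : ℝ)⁻¹
  have t4 : Tendsto (fun n : ℕ => 1 - h * (n : ℝ)⁻¹) atTop (𝓝 1) := by
    simpa using tendsto_const_nhds.sub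
      ((tendsto_inv_atTop_nhds_zero_nat (𝕜 := ℝ)).const_mul (h : ℝ))
  -- The product of pooled means does not depend on `t` and occurs `n - h` times, hence its weight
  -- `1 - h/n`. The constant is `n * ((1 - h/n) * A h - A h)`.
  have key := (((t4.mul t3).sub t1).sub t2).add_const (-(h * A h))
  have el : (1 * ((R.card : ℝ)⁻¹ * ∑' k, A k) - (R.card : ℝ)⁻¹ * ∑' k, A k -
      (R.card : ℝ)⁻¹ * ∑' k, A k + -(h * A h)) = -(h * A h) - (∑' k, A k) / R.card := by
    ring
  rw [el] at key
  refine key.congr' ?_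
  filter_upwards [eventually_ge_atTop (h + 1)] with n hn
  have hn0 : (n : ℝ) ≠ 0 := by
    have : n ≠ 0 := by omega
    exact_mod_cast this
  rw [integral_crossProduct hU hV hUV hs]
  simp only [Finset.sum_add_distrib, Finset.sum_sub_distrib, Finset.sum_const, Finset.card_range,
    nsmul_eq_mul, ← Finset.mul_sum, Nat.cast_sub (show h ≤ n by omega)]
  field_simp
  ring

end CrossProduct

/-! ### Stationary covariances of independent chains -/

section Symmetry

variable {Ω : Type*} [MeasurableSpace Ω] {Pr : Measure Ω} {d : ℕ}

lemma autocov_neg (Y : ℕ → Ω → EuclideanSpace ℝ (Fin d)) (k : ℤ) (i j : Fin d) :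
    autocov Pr Y (-k) i j = autocov Pr Y k j i := by
  simp only [autocov, Matrix.of_apply, neg_neg]
  exact covariance_comm _ _

lemma longRunCov_comm (Y : ℕ → Ω → EuclideanSpace ℝ (Fin d)) (i j : Fin d) :
    longRunCov Pr Y i j = longRunCov Pr Y j i := by
  simp only [longRunCov, Matrix.of_apply]
  rw [← (Equiv.neg ℤ).tsum_eq]
  exact tsum_congr fun k => autocov_neg Y k i j

end Symmetry

section Stationary

variable {Ω α : Type*} [MeasurableSpace Ω] [MeasurableSpace α] {Pr : Measure Ω}
  [IsProbabilityMeasure Pr] {P : Kernel α α} [IsMarkovKernel P] {F : Measure α}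
  [IsProbabilityMeasure F]

lemma IsMarkovChain.measurePreserving {X : ℕ → Ω → α} (hX : IsMarkovChain Pr P F X)
    (hinv : Kernel.Invariant P F) (t : ℕ) : MeasurePreserving (X t) Pr F :=
  ⟨hX.measurable t, hX.map_eq hinv t⟩

lemma IsMarkovChain.covariance_eq {X : ℕ → Ω → α} (hX : IsMarkovChain Pr P F X)
    (hinv : Kernel.Invariant P F) {f g : α → ℝ} (hf : Measurable f) (hg : Measurable g)
    (hf2 : MemLp f 2 F) (hg2 : MemLp g 2 F) (t l : ℕ) :
    covariance (fun ω => f (X t ω)) (fun ω => g (X (t + l) ω)) Pr =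
      ∫ p, f p.1 * g p.2 ∂(F ⊗ₘ (P ^ l)) - (∫ x, f x ∂F) * ∫ x, g x ∂F := by
  have mp := hX.measurePreserving hinv
  have hm := hX.measurable
  have e (h : α → ℝ) (hh : Measurable h) (t : ℕ) : ∫ ω, h (X t ω) ∂Pr = ∫ x, h x ∂F := by
    rw [← hX.map_eq hinv t, integral_map (by fun_prop) hh.aestronglyMeasurable]
  have hft : MemLp (fun ω => f (X t ω)) 2 Pr := hf2.comp_measurePreserving (mp t)
  have hgt : MemLp (fun ω => g (X (t + l) ω)) 2 Pr := hg2.comp_measurePreserving (mp (t + l))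
  rw [covariance_eq_sub hft hgt, e f hf, e g hg, ← hX.map_pair hinv t l,
    integral_map (by fun_prop) (by fun_prop)]
  rfl

variable {m d : ℕ} {X : Fin m → ℕ → Ω → α} {φ : α → EuclideanSpace ℝ (Fin d)}

/-- All chains have the same two-point laws, so the autocovariance of the fixed chain `s` describes
every chain `r`. For `v < u` the roles of the two times are swapped. -/
lemma covariance_eq_autocov (hX : ∀ s, IsMarkovChain Pr P F (X s))
    (hinv : Kernel.Invariant P F) (hφ : Measurable φ) (hφ2 : ∀ i, MemLp (fun x => φ x i) 2 F)
    (s r : Fin m) (u v : ℕ) (i j : Fin d) :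
    covariance (fun ω => φ (X r u ω) i) (fun ω => φ (X r v ω) j) Pr =
      autocov Pr (fun t ω => φ (X s t ω)) ((v : ℤ) - u) i j := by
  have hm (i : Fin d) : Measurable fun x => φ x i := by fun_prop
  simp only [autocov, Matrix.of_apply]
  rcases le_total u v with h | h
  · obtain ⟨l, rfl⟩ := Nat.exists_eq_add_of_le h
    have e1 : (-(((u + l : ℕ) : ℤ) - u)).toNat = 0 := by omega
    have e2 : (((u + l : ℕ) : ℤ) - u).toNat = 0 + l := by omega
    rw [e1, e2, (hX r).covariance_eq hinv (hm i) (hm j) (hφ2 i) (hφ2 j),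
      (hX s).covariance_eq hinv (hm i) (hm j) (hφ2 i) (hφ2 j)]
  · obtain ⟨l, rfl⟩ := Nat.exists_eq_add_of_le h
    have e1 : (-((v : ℤ) - (v + l : ℕ))).toNat = 0 + l := by omega
    have e2 : ((v : ℤ) - (v + l : ℕ)).toNat = 0 := by omega
    rw [e1, e2, covariance_comm, (hX r).covariance_eq hinv (hm j) (hm i) (hφ2 j) (hφ2 i),
      covariance_comm, (hX s).covariance_eq hinv (hm j) (hm i) (hφ2 j) (hφ2 i)]

lemma integral_centered_mul (hX : ∀ s, IsMarkovChain Pr P F (X s))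
    (hinv : Kernel.Invariant P F) (hφ : Measurable φ) (hφ2 : ∀ i, MemLp (fun x => φ x i) 2 F)
    (hindep : iIndepFun (fun (s : Fin m) (ω : Ω) (t : ℕ) => X s t ω) Pr)
    (s : Fin m) (i j : Fin d) (r : Fin m) (u : ℕ) (r' : Fin m) (v : ℕ) :
    ∫ ω, (φ (X r u ω) i - ∫ x, φ x i ∂F) * (φ (X r' v ω) j - ∫ x, φ x j ∂F) ∂Pr =
      if r = r' then autocov Pr (fun t ω => φ (X s t ω)) ((v : ℤ) - u) i j else 0 := by
  have hm (i : Fin d) : Measurable fun x => φ x i := by fun_prop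
  have e (r : Fin m) (t : ℕ) (i : Fin d) : ∫ x, φ x i ∂F = ∫ ω, φ (X r t ω) i ∂Pr := by
    rw [← (hX r).map_eq hinv t,
      integral_map ((hX r).measurable t).aemeasurable (hm i).aestronglyMeasurable]
  rw [e r u i, e r' v j]
  change covariance (fun ω => φ (X r u ω) i) (fun ω => φ (X r' v ω) j) Pr = _
  split_ifs with h
  · subst h
    exact covariance_eq_autocov hX hinv hφ hφ2 s r u v i j
  · have hi : IndepFun (fun ω => φ (X r u ω) i) (fun ω => φ (X r' v ω) j) Pr :=
      (hindep.indepFun h).comp (φ := fun x : ℕ → α => φ (x u) i) (ψ := fun x : ℕ → α => φ (x v) j)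
        (by fun_prop) (by fun_prop)
    exact hi.covariance_eq_zero
      ((hφ2 i).comp_measurePreserving ((hX r).measurePreserving hinv u))
      ((hφ2 j).comp_measurePreserving ((hX r').measurePreserving hinv v))

lemma summable_autocov {s : Fin m} {δ ε ξ : ℝ} (hX : ∀ s, IsMarkovChain Pr P F (X s))
    (hinv : Kernel.Invariant P F) (hφ : Measurable φ) (hδ : 0 < δ) (hε : 0 < ε)
    (hmom : ∀ i, Integrable (fun x => |φ x i| ^ (2 + δ)) F)
    (hξ : (2 + ε) * (1 + 2 / δ) < ξ) (hP : PolynomiallyErgodic P F ξ) (i j : Fin d) :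
    (Summable fun l : ℤ => |autocov Pr (fun t ω => φ (X s t ω)) l i j|) ∧
      Summable fun l : ℤ => |(l : ℝ)| * |autocov Pr (fun t ω => φ (X s t ω)) l i j| := by
  have hm (i : Fin d) : Measurable fun x => φ x i := by fun_prop
  have h2 (i : Fin d) := memLp_two_of_integrable_rpow (hm i) hδ (hmom i)
  have key (i j : Fin d) : ∃ C : ℝ, ∀ l : ℕ, 1 ≤ l →
      |autocov Pr (fun t ω => φ (X s t ω)) l i j| ≤ C * (l : ℝ) ^ (-(2 + ε)) := by
    obtain ⟨C, hC⟩ := hP.exists_abs_covariance_le hinv (hm i) (hm j) hδ hξ (hmom i) (hmom j)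
    refine ⟨C, fun l hl => ?_⟩
    have e := covariance_eq_autocov hX hinv hφ h2 s s 0 (0 + l) i j
    rw [(hX s).covariance_eq hinv (hm i) (hm j) (h2 i) (h2 j)] at e
    have e0 : (((0 + l : ℕ) : ℤ) - (0 : ℕ)) = l := by simp
    rw [e0] at e
    rw [← e]
    exact hC l hl
  obtain ⟨C₁, h₁⟩ := key i j
  obtain ⟨C₂, h₂⟩ := key j i
  exact summable_of_abs_le_rpow hε h₁ fun l hl => by
    rw [autocov_neg]; exact h₂ l hl

end Stationary

/-! ### Bias of the empirical autocovariances -/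

section Estimator

variable {m d : ℕ}

/-- Average of the sample means of the chains in `R`. -/
noncomputable def poolMean (R : Finset (Fin m)) (n : ℕ)
    (y : Fin m → ℕ → EuclideanSpace ℝ (Fin d)) : EuclideanSpace ℝ (Fin d) :=
  (R.card : ℝ)⁻¹ • ∑ r ∈ R, chainMean n (y r)

lemma poolMean_univ (n : ℕ) (y : Fin m → ℕ → EuclideanSpace ℝ (Fin d)) :
    poolMean Finset.univ n y = globalMean n y := by
  simp [poolMean, globalMean]

lemma poolMean_singleton (s : Fin m) (n : ℕ) (y : Fin m → ℕ → EuclideanSpace ℝ (Fin d)) :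
    poolMean {s} n y = chainMean n (y s) := by
  simp [poolMean]

lemma poolMean_apply (R : Finset (Fin m)) (n : ℕ) (y : Fin m → ℕ → EuclideanSpace ℝ (Fin d))
    (i : Fin d) : poolMean R n y i = poolAvg R n fun r t => y r t i := by
  simp [poolMean, poolAvg, chainMean, Finset.mul_sum]

lemma lagProduct_poolMean_apply (R : Finset (Fin m)) (n : ℕ)
    (y : Fin m → ℕ → EuclideanSpace ℝ (Fin d)) (s : Fin m) (h : ℕ) (i j : Fin d) :
    lagProduct n (poolMean R n y) (y s) h i j =
      (n : ℝ)⁻¹ * ∑ t ∈ Finset.range (n - h), (y s t i - poolAvg R n fun r t => y r t i) *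
        (y s (t + h) j - poolAvg R n fun r t => y r t j) := by
  simp [lagProduct, Matrix.sum_apply, Matrix.vecMulVec_apply, poolMean_apply]

variable {Ω α : Type*} [MeasurableSpace Ω] [MeasurableSpace α] {Pr : Measure Ω}
  [IsProbabilityMeasure Pr] {P : Kernel α α} [IsMarkovKernel P] {F : Measure α}
  [IsProbabilityMeasure F] {X : Fin m → ℕ → Ω → α} {φ : α → EuclideanSpace ℝ (Fin d)}

lemma integrable_lagProduct_poolMean (hX : ∀ s, IsMarkovChain Pr P F (X s))
    (hinv : Kernel.Invariant P F) (hφ2 : ∀ i, MemLp (fun x => φ x i) 2 F)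
    (R : Finset (Fin m)) (s : Fin m) (n h : ℕ) (i j : Fin d) :
    Integrable (fun ω => lagProduct n (poolMean R n fun r t => φ (X r t ω))
      (fun t => φ (X s t ω)) h i j) Pr := by
  have hY (i : Fin d) (r : Fin m) (t : ℕ) : MemLp (fun ω => φ (X r t ω) i) 2 Pr :=
    (hφ2 i).comp_measurePreserving ((hX r).measurePreserving hinv t)
  refine (integrable_crossProduct (hY i) (hY j) R s n h).congr (ae_of_all _ fun ω => ?_)
  exact (lagProduct_poolMean_apply R n (fun r t => φ (X r t ω)) s h i j).symm

lemma tendsto_mul_integral_lagProduct_sub (hX : ∀ s, IsMarkovChain Pr P F (X s))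
    (hinv : Kernel.Invariant P F) (hφ : Measurable φ) (hφ2 : ∀ i, MemLp (fun x => φ x i) 2 F)
    (hindep : iIndepFun (fun (s : Fin m) (ω : Ω) (t : ℕ) => X s t ω) Pr)
    {R : Finset (Fin m)} {s : Fin m} (hs : s ∈ R) (h : ℕ) (i j : Fin d)
    (hA : Summable fun l : ℤ => |autocov Pr (fun t ω => φ (X s t ω)) l i j|) :
    Tendsto (fun n : ℕ => (n : ℝ) * ((∫ ω, lagProduct n (poolMean R n fun r t => φ (X r t ω))
      (fun t => φ (X s t ω)) h i j ∂Pr) - autocov Pr (fun t ω => φ (X s t ω)) h i j)) atTop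
      (𝓝 (-(h * autocov Pr (fun t ω => φ (X s t ω)) h i j) -
        longRunCov Pr (fun t ω => φ (X s t ω)) i j / R.card)) := by
  have hU (i : Fin d) (r : Fin m) (t : ℕ) :
      MemLp (fun ω => φ (X r t ω) i - ∫ x, φ x i ∂F) 2 Pr :=
    ((hφ2 i).comp_measurePreserving ((hX r).measurePreserving hinv t)).sub (memLp_const _)
  refine (tendsto_mul_integral_crossProduct_sub (hU i) (hU j)
    (integral_centered_mul hX hinv hφ hφ2 hindep s i j) hA hs h).congr' ?_
  -- Subtracting the true mean cancels between an observation and the pooled mean, but only for `n ≠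
  -- 0`: the empty average is `0` whatever the constant.
  filter_upwards [eventually_ne_atTop 0] with n hn
  congr 3
  ext ω
  rw [lagProduct_poolMean_apply R n (fun r t => φ (X r t ω))]
  simp only [poolAvg_sub_const ⟨s, hs⟩ hn, sub_sub_sub_cancel_right]

lemma integrable_sampleAutocov_poolMean (hX : ∀ s, IsMarkovChain Pr P F (X s))
    (hinv : Kernel.Invariant P F) (hφ2 : ∀ i, MemLp (fun x => φ x i) 2 F)
    (R : Finset (Fin m)) (s : Fin m) (n : ℕ) (k : ℤ) (i j : Fin d) :
    Integrable (fun ω => sampleAutocov n (poolMean R n fun r t => φ (X r t ω))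
      (fun t => φ (X s t ω)) k i j) Pr := by
  unfold sampleAutocov
  split_ifs
  · exact integrable_lagProduct_poolMean hX hinv hφ2 R s n _ i j
  · exact integrable_lagProduct_poolMean hX hinv hφ2 R s n _ j i

lemma tendsto_mul_integral_sampleAutocov_sub (hX : ∀ s, IsMarkovChain Pr P F (X s))
    (hinv : Kernel.Invariant P F) (hφ : Measurable φ) (hφ2 : ∀ i, MemLp (fun x => φ x i) 2 F)
    (hindep : iIndepFun (fun (s : Fin m) (ω : Ω) (t : ℕ) => X s t ω) Pr)
    {R : Finset (Fin m)} {s : Fin m} (hs : s ∈ R) (k : ℤ) (i j : Fin d)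
    (hA : Summable fun l : ℤ => |autocov Pr (fun t ω => φ (X s t ω)) l i j|) :
    Tendsto (fun n : ℕ => (n : ℝ) * ((∫ ω, sampleAutocov n (poolMean R n fun r t => φ (X r t ω))
      (fun t => φ (X s t ω)) k i j ∂Pr) - autocov Pr (fun t ω => φ (X s t ω)) k i j)) atTop
      (𝓝 (-(|(k : ℝ)| * autocov Pr (fun t ω => φ (X s t ω)) k i j) -
        longRunCov Pr (fun t ω => φ (X s t ω)) i j / R.card)) := by
  unfold sampleAutocov
  split_ifs with hk
  · obtain ⟨h, rfl⟩ := Int.eq_ofNat_of_zero_le hk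
    simpa using tendsto_mul_integral_lagProduct_sub hX hinv hφ hφ2 hindep hs h i j hA
  -- A negative lag is the transposed problem at entry `(j, i)`; the limit agrees because `Γ(-h)` is
  -- the transpose of `Γ(h)` and `Σ` is symmetric.
  · obtain ⟨h, hh⟩ := Int.eq_ofNat_of_zero_le (show 0 ≤ -k by omega)
    obtain rfl : k = -(h : ℤ) := by omega
    have hA' : Summable fun l : ℤ => |autocov Pr (fun t ω => φ (X s t ω)) l j i| := by
      refine (((Equiv.neg ℤ).summable_iff).2 hA).congr fun l => ?_
      simp [autocov_neg]
    simpa [autocov_neg, longRunCov_comm _ i j] using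
      tendsto_mul_integral_lagProduct_sub hX hinv hφ hφ2 hindep hs h j i hA'

end Estimator

/-! ### Consequences of a first-order bias expansion -/

/-- Expanding the product, `n` times the remainder is `n (E n - g) + K g + S + (p - K S)/n - K
p/n²`, which tends to `0` for any `p`. -/
lemma isLittleO_of_tendsto_mul_sub {E : ℕ → ℝ} {g K S p : ℝ}
    (h : Tendsto (fun n : ℕ => (n : ℝ) * (E n - g)) atTop (𝓝 (-(K * g) - S))) :
    (fun n : ℕ => E n - (1 - K / n) * (g - S / n - p / (n : ℝ) ^ 2)) =o[atTop]
      fun n : ℕ => (1 : ℝ) / n := by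
  have hn : ∀ᶠ n : ℕ in atTop, (n : ℝ) ≠ 0 := by
    filter_upwards [eventually_ne_atTop 0] with n hn
    exact_mod_cast hn
  refine (isLittleO_iff_tendsto' (hn.mono fun n hn h0 => absurd h0 (by positivity))).2 ?_
  have h0 := tendsto_inv_atTop_nhds_zero_nat (𝕜 := ℝ)
  have key := (h.add_const (K * g + S)).add
    ((h0.const_mul (p - K * S)).sub ((h0.mul h0).const_mul (K * p)))
  have el : -(K * g) - S + (K * g + S) + ((p - K * S) * 0 - K * p * (0 * 0)) = 0 := by ring
  rw [el] at key
  refine key.congr' ?_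
  filter_upwards [hn] with n hn
  field_simp
  ring

lemma eventually_abs_lt_of_tendsto_mul {a b : ℕ → ℝ} {x y : ℝ}
    (ha : Tendsto (fun n : ℕ => (n : ℝ) * a n) atTop (𝓝 x))
    (hb : Tendsto (fun n : ℕ => (n : ℝ) * b n) atTop (𝓝 y)) (hxy : |x| < |y|) :
    ∀ᶠ n in atTop, |a n| < |b n| := by
  filter_upwards [ha.abs.eventually_lt hb.abs hxy] with n hn
  rw [abs_mul, abs_mul] at hn
  exact lt_of_mul_lt_mul_left hn (abs_nonneg _)

end GACvF

theorem theorem1 {d m : ℕ} (S : Set (EuclideanSpace ℝ (Fin d))) [𝓑 : MeasurableSpace S]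
    [MeasurableSpace.CountablyGenerated S]
    (hS : Measurable (fun x : S => (x : EuclideanSpace ℝ (Fin d))))
    (F : Measure S) [IsProbabilityMeasure F]
    (P : Kernel S S) [IsMarkovKernel P] (hinv : Kernel.Invariant P F)
    {Ω : Type*} [MeasurableSpace Ω] (Pr : Measure Ω) [IsProbabilityMeasure Pr]
    (X : Fin m → ℕ → Ω → S)
    (hX : ∀ s, GACvF.IsMarkovChain Pr P F (X s))
    (hindep : iIndepFun (fun (s : Fin m) (ω : Ω) (t : ℕ) => X s t ω) Pr)
    (δ ε ξ : ℝ) (hδ : 0 < δ) (hε : 0 < ε)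
    (hmoment : Integrable (fun x : S => ‖(x : EuclideanSpace ℝ (Fin d))‖ ^ (2 + δ)) F)
    (hξ : (2 + ε) * (1 + 2 / δ) < ξ)
    (hP : GACvF.PolynomiallyErgodic P F ξ)
    (s : Fin m) (k : ℤ) (i j : Fin d) :
    let Y : Fin m → ℕ → Ω → EuclideanSpace ℝ (Fin d) := fun r t ω => (X r t ω)
    let Γ : ℤ → Matrix (Fin d) (Fin d) ℝ := GACvF.autocov Pr (Y s)
    let Sig : Matrix (Fin d) (Fin d) ℝ := GACvF.longRunCov Pr (Y s)
    let Φ : Matrix (Fin d) (Fin d) ℝ := GACvF.lagWeightedCov Pr (Y s)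
    let ΓG : ℕ → Ω → Matrix (Fin d) (Fin d) ℝ := fun n ω =>
      GACvF.globalACvF n (fun r t => Y r t ω) s k
    let ΓL : ℕ → Ω → Matrix (Fin d) (Fin d) ℝ := fun n ω =>
      GACvF.localACvF n (fun r t => Y r t ω) s k
    -- the series defining `Σ` and `Φ` converge absolutely
    (Summable fun l : ℤ => |Γ l i j|) ∧
    (Summable fun l : ℤ => |(l : ℝ)| * |Γ l i j|) ∧
    -- the estimators have expectations
    (∀ n, Integrable (fun ω => ΓG n ω i j) Pr ∧ Integrable (fun ω => ΓL n ω i j) Pr) ∧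
    -- expectation of the globally-centered estimator
    ((fun n : ℕ => GACvF.expMatrix Pr (ΓG n) i j -
        (1 - |(k : ℝ)| / n) * (Γ k i j - Sig i j / (m * n) - Φ i j / (m * (n : ℝ) ^ 2)))
      =o[atTop] fun n : ℕ => (1 : ℝ) / n) ∧
    -- expectation of the locally-centered estimator
    ((fun n : ℕ => GACvF.expMatrix Pr (ΓL n) i j -
        (1 - |(k : ℝ)| / n) * (Γ k i j - Sig i j / n - Φ i j / (n : ℝ) ^ 2))
      =o[atTop] fun n : ℕ => (1 : ℝ) / n) ∧
    -- with at least two chains and positive covariances, the global bias is eventually smaller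
    (2 ≤ m → 0 ≤ Γ k i j → 0 < Sig i j →
      ∀ᶠ n : ℕ in atTop,
        |GACvF.expMatrix Pr (ΓG n) i j - Γ k i j| < |GACvF.expMatrix Pr (ΓL n) i j - Γ k i j|) := by
  have hm (i : Fin d) : Measurable fun x : S => (x : EuclideanSpace ℝ (Fin d)) i := by fun_prop
  have hmom (i : Fin d) :
      Integrable (fun x : S => |(x : EuclideanSpace ℝ (Fin d)) i| ^ (2 + δ)) F := by
    refine hmoment.mono' ((hm i).abs.pow_const _).aestronglyMeasurable (ae_of_all _ fun x => ?_)
    rw [Real.norm_eq_abs, abs_of_nonneg (Real.rpow_nonneg (abs_nonneg _) _)]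
    exact Real.rpow_le_rpow (abs_nonneg _) (PiLp.norm_apply_le x.1 i) (by linarith)
  have h2 (i : Fin d) := GACvF.memLp_two_of_integrable_rpow (hm i) hδ (hmom i)
  intro Y Γ Sig Φ ΓG ΓL
  obtain ⟨hA, hA'⟩ := GACvF.summable_autocov (s := s) hX hinv hS hδ hε hmom hξ hP i j
  have eG (n : ℕ) : (fun ω => ΓG n ω i j) = fun ω => GACvF.sampleAutocov n
      (GACvF.poolMean Finset.univ n fun r t => Y r t ω) (fun t => Y s t ω) k i j := by
    simp only [GACvF.poolMean_univ]; rfl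
  have eL (n : ℕ) : (fun ω => ΓL n ω i j) = fun ω => GACvF.sampleAutocov n
      (GACvF.poolMean {s} n fun r t => Y r t ω) (fun t => Y s t ω) k i j := by
    simp only [GACvF.poolMean_singleton]; rfl
  have tG := GACvF.tendsto_mul_integral_sampleAutocov_sub hX hinv hS h2 hindep
    (Finset.mem_univ s) k i j hA
  have tL := GACvF.tendsto_mul_integral_sampleAutocov_sub hX hinv hS h2 hindep
    (Finset.mem_singleton_self s) k i j hA
  simp only [Finset.card_univ, Fintype.card_fin] at tG
  simp only [Finset.card_singleton, Nat.cast_one, div_one] at tL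
  replace tG : Tendsto (fun n : ℕ => (n : ℝ) * (GACvF.expMatrix Pr (ΓG n) i j - Γ k i j)) atTop
      (𝓝 (-(|(k : ℝ)| * Γ k i j) - Sig i j / m)) := by
    simp only [GACvF.expMatrix, Matrix.of_apply, eG]
    exact tG
  replace tL : Tendsto (fun n : ℕ => (n : ℝ) * (GACvF.expMatrix Pr (ΓL n) i j - Γ k i j)) atTop
      (𝓝 (-(|(k : ℝ)| * Γ k i j) - Sig i j)) := by
    simp only [GACvF.expMatrix, Matrix.of_apply, eL]
    exact tL
  refine ⟨hA, hA', fun n => ⟨?_, ?_⟩, ?_, ?_, fun hm2 hΓ hSig => ?_⟩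
  · rw [eG]
    exact GACvF.integrable_sampleAutocov_poolMean hX hinv h2 Finset.univ s n k i j
  · rw [eL]
    exact GACvF.integrable_sampleAutocov_poolMean hX hinv h2 {s} s n k i j
  · simpa only [div_div] using GACvF.isLittleO_of_tendsto_mul_sub (p := Φ i j / m) tG
  · exact GACvF.isLittleO_of_tendsto_mul_sub tL
  · refine GACvF.eventually_abs_lt_of_tendsto_mul tG tL ?_
    have hm2' : (1 : ℝ) < m := by exact_mod_cast hm2
    have h1 : Sig i j / m < Sig i j := div_lt_self hSig hm2'
    have h0 : 0 ≤ Sig i j / m := by positivity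
    have hk : 0 ≤ |(k : ℝ)| * Γ k i j := mul_nonneg (abs_nonneg _) hΓ
    generalize |(k : ℝ)| * Γ k i j = K at hk ⊢
    -- Both limits of the scaled biases are nonpositive, so the comparison is `K + Σ/m < K + Σ` at
    -- entry `(i, j)`.
    rw [abs_of_nonpos (by linarith), abs_of_nonpos (by linarith)]
    linarith
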